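/- Let $\mathsf h$ be a finite-dimensional complex Hilbert space, $H_S$ a self-adjoint operator on $\mathsf h$ with spectral decomposition $H_S=\sum_n \varepsilon_n P_{\varepsilon_n}$ (distinct $\varepsilon_n$), and $(e_j)_{1\le j\le d}$ an orthonormal basis of $\mathsf h$ consisting of eigenvectors of $H_S$. The Bohr frequencies are the differences $\omega=\varepsilon_n-\varepsilon_m$ with $\varepsilon_n>\varepsilon_m$. Fix an operator $V$ on $\mathsf h$ and, for each Bohr frequency $\omega$, put $$V_\omega=\sum_{\varepsilon_n-\varepsilon_m=\omega}P_{\varepsilon_m}VP_{\varepsilon_n},$$ and let $\gamma_\omega^-,\gamma_\omega^+>0$ and $H_\omega$ be a self-adjoint operator commuting with $H_S$. Define on $\mathcal B(\mathsf h)$ $$\mathcal L_\omega(x)=\mathrm i[H_\omega,x]-\frac{\gamma_\omega^-}{2}\left(V_\omega^*V_\omega x-2V_\omega^*xV_\omega+xV_\omega^*V_\omega\right)-\frac{\gamma_\omega^+}{2}\left(V_\omega V_\omega^* x-2V_\omega xV_\omega^*+xV_\omega V_\omega^*\right),\qquad \mathcal L=\sum_\omega\mathcal L_\omega ,$$ and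 let the quantum Markov semigroups (QMS) generated by them be $e^{t\mathcal L_\omega}$ and $e^{t\mathcal L}$, $t\ge0$. Let $\rho$ be the density of a faithful state that commutes with $H_S$ and is invariant for the QMS generated by $\mathcal L$ (a state $\rho$ is invariant for $\mathcal T$ if $\operatorname{tr}(\rho\mathcal T_t(x))=\operatorname{tr}(\rho x)$ for all $x\in\mathcal B(\mathsf h)$, $t\ge 0$). Let $\Theta(a)=a^{\intercal}$ be the transposition with respect to $(e_j)$. A QMS $\mathcal T$ satisfies the standard quantum detailed balance condition SQDB-$\Theta$ with respect to $\rho$ if its dual $\mathcal T'$, defined by $$\operatorname{tr}\left(\rho^{1/2}x\rho^{1/2}\mathcal T_t(y)\right)=\operatorname{tr}\left(\rho^{1/2}\mathcal T'_t(x)\rho^{1/2}y\right)\qquad (x,y\in\mathcal B(\mathsf h),\ t\ge0),$$ is given by $\mathcal T'_t=\Theta\circ\mathcal T_t\circ\Theta$ for all $t\ge0$. Assume that, for every Bohr frequency $\omega$, $V_\omega$ is represented by a real matrix in the basis $(e_j)$ and $H_\omega$ is a linear combination of $V_\omega^*V_\omega$ and $V_\omega V_\omega^*$. Then the following are equivalent: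 1. the QMS generated by $\mathcal L$ satisfies SQDB-$\Theta$ with respect to $\rho$; 2. for every Bohr frequency $\omega$, the QMS generated by $\mathcal L_\omega$ admits $\rho$ as invariant state and satisfies SQDB-$\Theta$ with respect to $\rho$. -/

import Mathlib

namespace StochLimit

/-- The trace of an operator on a finite-dimensional Hilbert space. -/
noncomputable def tr {h : Type*} [NormedAddCommGroup h] [InnerProductSpace ℂ h]
    (a : h →L[ℂ] h) : ℂ :=
  LinearMap.trace ℂ h (a : h →ₗ[ℂ] h)

/-! ### Spectral decomposition, Bohr frequencies and the operators `V_ω` -/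

section Spectral

variable {h : Type*} [NormedAddCommGroup h] [InnerProductSpace ℂ h] [FiniteDimensional ℂ h]

/-- The eigenspace of `H` for the real number `ε`. -/
def eigenspace (H : h →L[ℂ] h) (ε : ℝ) : Submodule ℂ h :=
  Module.End.eigenspace (H : h →ₗ[ℂ] h) (ε : ℂ)

theorem finite_energies (H : h →L[ℂ] h) :
    {ε : ℝ | Module.End.HasEigenvalue (H : h →ₗ[ℂ] h) (ε : ℂ)}.Finite :=
  (Module.End.finite_hasEigenvalue (H : h →ₗ[ℂ] h)).preimage
    Complex.ofReal_injective.injOn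

/-- The finite set of (real) eigenvalues of `H`. -/
noncomputable def energies (H : h →L[ℂ] h) : Finset ℝ := (finite_energies H).toFinset

/-- The orthogonal projection onto the eigenspace of `H` for `ε`. -/
noncomputable def specProj (H : h →L[ℂ] h) (ε : ℝ) : h →L[ℂ] h :=
  (eigenspace H ε).starProjection

/-- The Bohr frequencies of `H`: the differences `ε - ε'` of eigenvalues `ε > ε'`. -/
noncomputable def bohr (H : h →L[ℂ] h) : Finset ℝ :=
  ((energies H ×ˢ energies H).filter fun p => p.2 < p.1).image fun p => p.1 - p.2

/-- `V_ω = ∑_{ε - ε' = ω} P_{ε'} V P_ε`, over pairs of eigenvalues `(ε, ε')` of `H`. -/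
noncomputable def freqPart (H V : h →L[ℂ] h) (ω : ℝ) : h →L[ℂ] h :=
  ∑ p ∈ (energies H ×ˢ energies H).filter fun p => p.1 - p.2 = ω,
    specProj H p.2 * V * specProj H p.1

end Spectral

/-! ### Generators and semigroups -/

/-- Left multiplication `x ↦ a x` on `B(h)`. -/
noncomputable def leftMul {h : Type*} [NormedAddCommGroup h] [InnerProductSpace ℂ h]
    (a : h →L[ℂ] h) : (h →L[ℂ] h) →L[ℂ] (h →L[ℂ] h) :=
  ContinuousLinearMap.mul ℂ (h →L[ℂ] h) a

/-- Right multiplication `x ↦ x a` on `B(h)`. -/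
noncomputable def rightMul {h : Type*} [NormedAddCommGroup h] [InnerProductSpace ℂ h]
    (a : h →L[ℂ] h) : (h →L[ℂ] h) →L[ℂ] (h →L[ℂ] h) :=
  (ContinuousLinearMap.mul ℂ (h →L[ℂ] h)).flip a

/-- The GKSL generator with Hamiltonian `H` and Kraus operators `√γm • v`, `√γp • v*`;
its values are given by `gksl_apply`. -/
noncomputable def gksl {h : Type*} [NormedAddCommGroup h] [InnerProductSpace ℂ h]
    [CompleteSpace h] (H v : h →L[ℂ] h) (γm γp : ℝ) :
    (h →L[ℂ] h) →L[ℂ] (h →L[ℂ] h) :=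
  Complex.I • (leftMul H - rightMul H)
    - ((γm : ℂ) / 2) • (leftMul (star v * v) - (2 : ℂ) • (leftMul (star v) * rightMul v)
        + rightMul (star v * v))
    - ((γp : ℂ) / 2) • (leftMul (v * star v) - (2 : ℂ) • (leftMul v * rightMul (star v))
        + rightMul (v * star v))

theorem gksl_apply {h : Type*} [NormedAddCommGroup h] [InnerProductSpace ℂ h]
    [CompleteSpace h] (H v : h →L[ℂ] h) (γm γp : ℝ) (x : h →L[ℂ] h) :
    gksl H v γm γp x = Complex.I • (H * x - x * H)
      - ((γm : ℂ) / 2) • (star v * v * x - (2 : ℂ) • (star v * x * v) + x * (star v * v))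
      - ((γp : ℂ) / 2) • (v * star v * x - (2 : ℂ) • (v * x * star v) + x * (v * star v)) := by
  simp [gksl, leftMul, rightMul, mul_assoc]

/-- The local generator `𝓛_ω` attached to the frequency `ω`. -/
noncomputable def localGen {h : Type*} [NormedAddCommGroup h] [InnerProductSpace ℂ h]
    [FiniteDimensional ℂ h] [CompleteSpace h] (HS V : h →L[ℂ] h) (Hω : ℝ → (h →L[ℂ] h))
    (γm γp : ℝ → ℝ) (ω : ℝ) : (h →L[ℂ] h) →L[ℂ] (h →L[ℂ] h) :=
  gksl (Hω ω) (freqPart HS V ω) (γm ω) (γp ω)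

/-- The generator `𝓛 = ∑_ω 𝓛_ω`, the sum being over all Bohr frequencies of `HS`. -/
noncomputable def globalGen {h : Type*} [NormedAddCommGroup h] [InnerProductSpace ℂ h]
    [FiniteDimensional ℂ h] [CompleteSpace h] (HS V : h →L[ℂ] h) (Hω : ℝ → (h →L[ℂ] h))
    (γm γp : ℝ → ℝ) : (h →L[ℂ] h) →L[ℂ] (h →L[ℂ] h) :=
  ∑ ω ∈ bohr HS, localGen HS V Hω γm γp ω

/-- The (norm continuous) semigroup `𝓣_t = exp (t L)` generated by a bounded operator `L` on a
Banach space `E`; it is used for `E = B(h)`. -/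
noncomputable def semigroup {E : Type*} [NormedAddCommGroup E] [NormedSpace ℂ E]
    (L : E →L[ℂ] E) (t : ℝ) : E →L[ℂ] E :=
  NormedSpace.exp ((t : ℂ) • L)

/-! ### States, duals and detailed balance -/

/-- `ρ` is the density of a faithful state. -/
def IsFaithfulState {h : Type*} [NormedAddCommGroup h] [InnerProductSpace ℂ h]
    [CompleteSpace h] (ρ : h →L[ℂ] h) : Prop :=
  ρ.IsPositive ∧ tr ρ = 1 ∧ ∀ x : h →L[ℂ] h, tr (ρ * (star x * x)) = 0 → x = 0

/-- `ρ` is invariant under the family `(T t)_{t ≥ 0}`. -/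
def IsInvariant {h : Type*} [NormedAddCommGroup h] [InnerProductSpace ℂ h]
    (T : ℝ → (h →L[ℂ] h) →L[ℂ] (h →L[ℂ] h)) (ρ : h →L[ℂ] h) : Prop :=
  ∀ t : ℝ, 0 ≤ t → ∀ x : h →L[ℂ] h, tr (ρ * T t x) = tr (ρ * x)

/-- `T'` is the dual of `T` for the bilinear form `(x, y) ↦ tr (ρ^{1/2} x ρ^{1/2} y)`. -/
def IsDual {h : Type*} [NormedAddCommGroup h] [InnerProductSpace ℂ h] [CompleteSpace h]
    (T T' : ℝ → (h →L[ℂ] h) →L[ℂ] (h →L[ℂ] h)) (ρ : h →L[ℂ] h) : Prop :=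
  ∀ t : ℝ, 0 ≤ t → ∀ x y : h →L[ℂ] h,
    tr (CFC.sqrt ρ * x * CFC.sqrt ρ * T t y) = tr (CFC.sqrt ρ * T' t x * CFC.sqrt ρ * y)

/-- The transpose of the operator `a` with respect to the orthonormal basis `e`. -/
noncomputable def transpose {h : Type*} [NormedAddCommGroup h] [InnerProductSpace ℂ h]
    [FiniteDimensional ℂ h] {d : ℕ} (e : OrthonormalBasis (Fin d) ℂ h) (a : h →L[ℂ] h) :
    h →L[ℂ] h :=
  LinearMap.toContinuousLinearMap
    (Matrix.toLin e.toBasis e.toBasis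
      (LinearMap.toMatrix e.toBasis e.toBasis (a : h →ₗ[ℂ] h)).transpose)

theorem inner_transpose {h : Type*} [NormedAddCommGroup h] [InnerProductSpace ℂ h]
    [FiniteDimensional ℂ h] {d : ℕ} (e : OrthonormalBasis (Fin d) ℂ h) (a : h →L[ℂ] h)
    (i j : Fin d) : inner ℂ (e i) (transpose e a (e j)) = inner ℂ (e j) (a (e i)) := by
  have := Matrix.toLin_self e.toBasis e.toBasis
    (LinearMap.toMatrix e.toBasis e.toBasis (a : h →ₗ[ℂ] h)).transpose j
  simp only [OrthonormalBasis.coe_toBasis] at this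
  simp [transpose, this, LinearMap.toMatrix_apply,
    OrthonormalBasis.repr_apply_apply, OrthonormalBasis.inner_eq_ite]

/-- The operator `a` is represented by a real matrix in the basis `e`. -/
def IsRealMatrix {h : Type*} [NormedAddCommGroup h] [InnerProductSpace ℂ h] {d : ℕ}
    (e : OrthonormalBasis (Fin d) ℂ h) (a : h →L[ℂ] h) : Prop :=
  ∀ i j, (inner ℂ (e i) (a (e j))).im = 0

/-- Standard quantum detailed balance with respect to `ρ` and the reversing operation
`Θ = transpose e`: the dual `T'` of `T` exists and `T' t = Θ ∘ T t ∘ Θ` for all `t ≥ 0`. -/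
def SQDBTheta {h : Type*} [NormedAddCommGroup h] [InnerProductSpace ℂ h]
    [FiniteDimensional ℂ h] [CompleteSpace h] {d : ℕ} (e : OrthonormalBasis (Fin d) ℂ h)
    (T : ℝ → (h →L[ℂ] h) →L[ℂ] (h →L[ℂ] h)) (ρ : h →L[ℂ] h) : Prop :=
  ∃ T' : ℝ → (h →L[ℂ] h) →L[ℂ] (h →L[ℂ] h), IsDual T T' ρ ∧
    ∀ t : ℝ, 0 ≤ t → ∀ x : h →L[ℂ] h, T' t x = transpose e (T t (transpose e x))

end StochLimit

namespace StochLimit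

section Operators

variable {h : Type*} [NormedAddCommGroup h] [InnerProductSpace ℂ h]

/-! ### The trace -/

theorem tr_add (a b : h →L[ℂ] h) : tr (a + b) = tr a + tr b := by simp [tr]

theorem tr_sub (a b : h →L[ℂ] h) : tr (a - b) = tr a - tr b := by simp [tr]

theorem tr_smul (c : ℂ) (a : h →L[ℂ] h) : tr (c • a) = c * tr a := by simp [tr]

theorem tr_zero : tr (0 : h →L[ℂ] h) = 0 := by simp [tr]

theorem tr_sum {ι : Type*} (s : Finset ι) (f : ι → h →L[ℂ] h) :
    tr (∑ i ∈ s, f i) = ∑ i ∈ s, tr (f i) := by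
  simp [tr]

theorem tr_mul_comm (a b : h →L[ℂ] h) : tr (a * b) = tr (b * a) :=
  LinearMap.trace_mul_comm ℂ (a : h →ₗ[ℂ] h) (b : h →ₗ[ℂ] h)

variable [FiniteDimensional ℂ h] [CompleteSpace h]

theorem eq_zero_of_tr_star_mul_self {a : h →L[ℂ] h} (ha : tr (star a * a) = 0) : a = 0 := by
  let b := stdOrthonormalBasis ℂ h
  have h1 : ∀ i, inner ℂ (b i) ((star a * a) (b i)) = ((‖a (b i)‖ ^ 2 : ℝ) : ℂ) := fun i => by
    rw [mul_apply_eq_comp, ContinuousLinearMap.star_eq_adjoint,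
      ContinuousLinearMap.adjoint_inner_right, inner_self_eq_norm_sq_to_K]
    norm_cast
  rw [tr, LinearMap.trace_eq_sum_inner _ b] at ha
  simp only [ContinuousLinearMap.coe_coe, h1] at ha
  rw [← Complex.ofReal_sum, Complex.ofReal_eq_zero,
    Finset.sum_eq_zero_iff_of_nonneg (fun _ _ => by positivity)] at ha
  have h2 : (a : h →ₗ[ℂ] h) = 0 := b.toBasis.ext fun i => by
    simpa using ha i (Finset.mem_univ i)
  exact ContinuousLinearMap.coe_injective (by simpa using h2)

theorem eq_of_tr_mul_eq {a b : h →L[ℂ] h} (hab : ∀ y, tr (a * y) = tr (b * y)) : a = b := by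
  have h1 : star (a - b) = 0 := eq_zero_of_tr_star_mul_self (by
    rw [star_star, sub_mul, tr_sub, hab, sub_self])
  exact sub_eq_zero.mp (star_eq_zero.mp h1)

end Operators

/-! ### The transposition -/

section Transpose

variable {h : Type*} [NormedAddCommGroup h] [InnerProductSpace ℂ h]
  {d : ℕ} (e : OrthonormalBasis (Fin d) ℂ h)

theorem ext_toMatrix {a b : h →L[ℂ] h}
    (hab : LinearMap.toMatrix e.toBasis e.toBasis (a : h →ₗ[ℂ] h) =
      LinearMap.toMatrix e.toBasis e.toBasis (b : h →ₗ[ℂ] h)) : a = b :=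
  ContinuousLinearMap.coe_injective ((LinearMap.toMatrix e.toBasis e.toBasis).injective hab)

theorem ext_inner_basis {a b : h →L[ℂ] h}
    (hab : ∀ i j, inner ℂ (e i) (a (e j)) = inner ℂ (e i) (b (e j))) : a = b := by
  apply ext_toMatrix e
  ext i j
  simpa [LinearMap.toMatrix_apply, OrthonormalBasis.repr_apply_apply] using hab i j

variable [FiniteDimensional ℂ h]

theorem toMatrix_transpose (a : h →L[ℂ] h) :
    LinearMap.toMatrix e.toBasis e.toBasis (transpose e a : h →ₗ[ℂ] h) =
      (LinearMap.toMatrix e.toBasis e.toBasis (a : h →ₗ[ℂ] h)).transpose := by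
  simp only [transpose, LinearMap.coe_toContinuousLinearMap, LinearMap.toMatrix_toLin]

theorem transpose_transpose (a : h →L[ℂ] h) : transpose e (transpose e a) = a :=
  ext_toMatrix e (by rw [toMatrix_transpose, toMatrix_transpose, Matrix.transpose_transpose])

theorem transpose_add (a b : h →L[ℂ] h) :
    transpose e (a + b) = transpose e a + transpose e b := by
  simp [transpose]

theorem transpose_smul (c : ℂ) (a : h →L[ℂ] h) :
    transpose e (c • a) = c • transpose e a := by
  simp [transpose]

theorem transpose_mul (a b : h →L[ℂ] h) :
    transpose e (a * b) = transpose e b * transpose e a := by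
  apply ext_toMatrix e
  simp only [ContinuousLinearMap.toLinearMap_mul, LinearMap.toMatrix_mul, toMatrix_transpose,
    Matrix.transpose_mul]

/-- The transposition as a bounded linear map. -/
noncomputable def transposeCLM : (h →L[ℂ] h) →L[ℂ] (h →L[ℂ] h) :=
  LinearMap.toContinuousLinearMap
    { toFun := transpose e, map_add' := transpose_add e, map_smul' := transpose_smul e }

@[simp] theorem transposeCLM_apply (a : h →L[ℂ] h) : transposeCLM e a = transpose e a := rfl

theorem transpose_sub (a b : h →L[ℂ] h) :
    transpose e (a - b) = transpose e a - transpose e b :=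
  map_sub (transposeCLM e) a b

variable [CompleteSpace h]

theorem IsRealMatrix.transpose_eq_star {e : OrthonormalBasis (Fin d) ℂ h} {v : h →L[ℂ] h}
    (hv : IsRealMatrix e v) : transpose e v = star v := by
  refine ext_inner_basis e fun i j => ?_
  rw [inner_transpose, ContinuousLinearMap.star_eq_adjoint,
    ContinuousLinearMap.adjoint_inner_right, ← inner_conj_symm]
  rw [← inner_conj_symm, Complex.conj_conj]
  exact (Complex.conj_eq_iff_im.mpr (hv j i)).symm.trans (by rw [inner_conj_symm])

theorem IsRealMatrix.transpose_star {e : OrthonormalBasis (Fin d) ℂ h} {v : h →L[ℂ] h}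
    (hv : IsRealMatrix e v) : transpose e (star v) = v := by
  rw [← hv.transpose_eq_star, transpose_transpose]

end Transpose

/-! ### Semigroups and their generators -/

section Semigroup

variable {E : Type*} [NormedAddCommGroup E] [NormedSpace ℂ E] [CompleteSpace E]

theorem hasDerivAt_semigroup_zero (L : E →L[ℂ] E) : HasDerivAt (semigroup L) L 0 := by
  have h1 := (hasDerivAt_exp_smul_const (𝕂 := ℂ) L ((0 : ℝ) : ℂ)).scomp (0 : ℝ)
    Complex.ofRealCLM.hasDerivAt
  change HasDerivAt (fun t : ℝ => NormedSpace.exp ((t : ℂ) • L)) L 0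
  simpa [Function.comp_def] using h1

/-- A semigroup maps into a closed subspace of operators if its generator's powers do. -/
theorem semigroup_mem {S : Submodule ℂ (E →L[ℂ] E)} (hS : IsClosed (S : Set (E →L[ℂ] E)))
    {L : E →L[ℂ] E} (hL : ∀ n : ℕ, L ^ n ∈ S) (t : ℝ) : semigroup L t ∈ S := by
  have h1 := NormedSpace.exp_series_hasSum_exp' (𝕂 := ℂ) ((t : ℂ) • L)
  refine hS.mem_of_tendsto h1 (Filter.Eventually.of_forall fun s => ?_)
  refine Submodule.sum_mem _ fun n _ => S.smul_mem _ ?_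
  rw [smul_pow]
  exact S.smul_mem _ (hL n)

/-- A semigroup is symmetric for a bilinear form if and only if its generator is. -/
theorem semigroup_symm_iff {B : E →L[ℂ] E →L[ℂ] ℂ} {L : E →L[ℂ] E} :
    (∀ t : ℝ, 0 ≤ t → ∀ x y, B x (semigroup L t y) = B (semigroup L t x) y) ↔
      ∀ x y, B x (L y) = B (L x) y := by
  constructor
  · intro hB x y
    have h1 : HasDerivAt (fun t => B x (semigroup L t y)) (B x (L y)) 0 :=
      ((((B x).comp (ContinuousLinearMap.apply ℂ E y)).restrictScalars ℝ).hasFDerivAt).comp_hasDerivAt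
        (0 : ℝ) (hasDerivAt_semigroup_zero L)
    have h2 : HasDerivAt (fun t => B (semigroup L t x) y) (B (L x) y) 0 :=
      ((((B.flip y).comp (ContinuousLinearMap.apply ℂ E x)).restrictScalars
        ℝ).hasFDerivAt).comp_hasDerivAt (0 : ℝ) (hasDerivAt_semigroup_zero L)
    refine (uniqueDiffWithinAt_Ici (0 : ℝ)).eq_deriv _ (h1.hasDerivWithinAt (s := Set.Ici 0)) ?_
    exact (h2.hasDerivWithinAt (s := Set.Ici 0)).congr (fun t ht => hB t ht x y)
      (hB 0 le_rfl x y)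
  · intro hB t _
    let S : Submodule ℂ (E →L[ℂ] E) :=
      { carrier := {T | ∀ x y, B x (T y) = B (T x) y}
        add_mem' := fun {T U} hT hU x y => by simp [hT x y, hU x y]
        zero_mem' := fun x y => by simp
        smul_mem' := fun c T hT x y => by simp [hT x y] }
    have hS : IsClosed (S : Set (E →L[ℂ] E)) := by
      have h1 : (S : Set (E →L[ℂ] E)) = ⋂ (x) (y), {T | B x (T y) = B (T x) y} := by
        ext T; simp [S]
      rw [h1]
      refine isClosed_iInter fun x => isClosed_iInter fun y => isClosed_eq ?_ ?_ <;> fun_prop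
    refine semigroup_mem hS (fun n => ?_) t
    induction n with
    | zero => intro x y; simp
    | succ n ih =>
      intro x y
      rw [pow_succ', mul_apply_eq_comp, hB, ih, ← mul_apply_eq_comp,
        ← pow_succ, pow_succ', mul_apply_eq_comp]

end Semigroup

end StochLimit

namespace StochLimit

/-! ### Detailed balance for a generator -/

section DetailedBalance

variable {h : Type*} [NormedAddCommGroup h] [InnerProductSpace ℂ h] [FiniteDimensional ℂ h]
  [CompleteSpace h] {d : ℕ} (e : OrthonormalBasis (Fin d) ℂ h)

/-- The bilinear form `(x, y) ↦ tr (σ xᵀ σ y)`. -/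
noncomputable def transposeForm (σ : h →L[ℂ] h) : (h →L[ℂ] h) →L[ℂ] (h →L[ℂ] h) →L[ℂ] ℂ :=
  (ContinuousLinearMap.compL ℂ (h →L[ℂ] h) (h →L[ℂ] h) ℂ
    (LinearMap.toContinuousLinearMap
      { toFun := tr, map_add' := tr_add, map_smul' := tr_smul })).comp
    ((ContinuousLinearMap.mul ℂ (h →L[ℂ] h)).comp
      ((rightMul σ).comp ((leftMul σ).comp (transposeCLM e))))

theorem transposeForm_apply (σ x y : h →L[ℂ] h) :
    transposeForm e σ x y = tr (σ * transpose e x * σ * y) := rfl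

theorem sqdbTheta_semigroup_iff (L : (h →L[ℂ] h) →L[ℂ] (h →L[ℂ] h)) (ρ : h →L[ℂ] h) :
    SQDBTheta e (semigroup L) ρ ↔ ∀ x y, tr (CFC.sqrt ρ * x * CFC.sqrt ρ * L y) =
      tr (CFC.sqrt ρ * transpose e (L (transpose e x)) * CFC.sqrt ρ * y) := by
  have h1 : (∀ x y, tr (CFC.sqrt ρ * x * CFC.sqrt ρ * L y) =
      tr (CFC.sqrt ρ * transpose e (L (transpose e x)) * CFC.sqrt ρ * y)) ↔
      ∀ x y, transposeForm e (CFC.sqrt ρ) x (L y) = transposeForm e (CFC.sqrt ρ) (L x) y := by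
    simp only [transposeForm_apply]
    refine ⟨fun hL x y => ?_, fun hL x y => ?_⟩
    · rw [hL, transpose_transpose]
    · rw [← hL, transpose_transpose]
  rw [h1, ← semigroup_symm_iff]
  simp only [transposeForm_apply]
  constructor
  · rintro ⟨T', hT', hΘ⟩ t ht x y
    rw [hT' t ht, hΘ t ht, transpose_transpose]
  · intro hL
    refine ⟨fun t => (transposeCLM e).comp ((semigroup L t).comp (transposeCLM e)),
      fun t ht x y => ?_, fun t _ x => rfl⟩
    simp only [ContinuousLinearMap.comp_apply, transposeCLM_apply]
    rw [← hL t ht, transpose_transpose]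

/-- A state satisfying detailed balance for a unital semigroup is invariant. -/
theorem SQDBTheta.isInvariant {e : OrthonormalBasis (Fin d) ℂ h}
    {T : ℝ → (h →L[ℂ] h) →L[ℂ] (h →L[ℂ] h)} {ρ : h →L[ℂ] h} (hT : SQDBTheta e T ρ)
    (hρ : 0 ≤ ρ) (h1 : ∀ t, 0 ≤ t → T t 1 = 1) : IsInvariant T ρ := by
  obtain ⟨T', hT', hΘ⟩ := hT
  have ht1 : transpose e (1 : h →L[ℂ] h) = 1 := by
    have h2 := transpose_mul e (transpose e 1) 1
    rwa [mul_one, transpose_transpose, mul_one, eq_comm] at h2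
  intro t ht x
  have h3 := hT' t ht 1 x
  rwa [hΘ t ht, ht1, h1 t ht, ht1, mul_one, CFC.sqrt_mul_sqrt_self ρ hρ] at h3

end DetailedBalance

theorem semigroup_apply_of_eq_zero {E : Type*} [NormedAddCommGroup E] [NormedSpace ℂ E]
    [CompleteSpace E] {L : E →L[ℂ] E} {x : E} (hx : L x = 0) (t : ℝ) :
    semigroup L t x = x := by
  have h1 := (NormedSpace.exp_series_hasSum_exp' (𝕂 := ℂ) ((t : ℂ) • L)).mapL
    (ContinuousLinearMap.apply ℂ E x)
  refine h1.unique ?_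
  convert hasSum_ite_eq 0 x with n
  cases n with
  | zero => simp
  | succ n =>
    rw [smul_pow, pow_succ]
    simp [hx]

/-! ### The predual generator and its defect from detailed balance -/

section Defect

variable {h : Type*} [NormedAddCommGroup h] [InnerProductSpace ℂ h] [CompleteSpace h]

/-- The adjoint of `gksl H v γm γp` for the bilinear form `(x, y) ↦ tr (x y)`. -/
noncomputable def predual (H v : h →L[ℂ] h) (γm γp : ℝ) (y : h →L[ℂ] h) : h →L[ℂ] h :=
  Complex.I • (y * H - H * y)
    - ((γm : ℂ) / 2) • (star v * v * y - (2 : ℂ) • (v * y * star v) + y * (star v * v))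
    - ((γp : ℂ) / 2) • (v * star v * y - (2 : ℂ) • (star v * y * v) + y * (v * star v))

theorem tr_mul_gksl (H v : h →L[ℂ] h) (γm γp : ℝ) (a x : h →L[ℂ] h) :
    tr (a * gksl H v γm γp x) = tr (predual H v γm γp a * x) := by
  have key : ∀ b c : h →L[ℂ] h, tr (a * (b * x * c)) = tr (c * a * b * x) := fun b c => by
    rw [tr_mul_comm (c * a * b) x, tr_mul_comm a, mul_assoc (b * x) c a, tr_mul_comm (b * x),
      ← mul_assoc, tr_mul_comm]
  have kl : ∀ b : h →L[ℂ] h, tr (a * (b * x)) = tr (a * b * x) := fun b => by rw [mul_assoc]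
  have kr : ∀ c : h →L[ℂ] h, tr (a * (x * c)) = tr (c * a * x) := fun c => by
    simpa using key 1 c
  rw [gksl_apply, predual]
  simp only [mul_sub, mul_add, sub_mul, add_mul, mul_smul_comm, smul_mul_assoc, tr_sub,
    tr_add, tr_smul, key, kl, kr, smul_sub, smul_add]
  ring

/-- The map `x ↦ a x b`. -/
def sandwich (a b : h →L[ℂ] h) : (h →L[ℂ] h) → (h →L[ℂ] h) := fun x => a * x * b

/-- The difference between `L_* (σ x σ)` and `σ (Θ L Θ) (x) σ` for `L = gksl H v γm γp`, when
`Θ` fixes `H` and exchanges `v` with `star v`. -/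
noncomputable def defect (σ H v : h →L[ℂ] h) (γm γp : ℝ) : (h →L[ℂ] h) → (h →L[ℂ] h) :=
  fun x => predual H v γm γp (σ * x * σ) - σ * gksl (-H) v γm γp x * σ

theorem transpose_gksl [FiniteDimensional ℂ h] {d : ℕ} {e : OrthonormalBasis (Fin d) ℂ h}
    {H v : h →L[ℂ] h} (hH : transpose e H = H) (hv : IsRealMatrix e v) (γm γp : ℝ)
    (x : h →L[ℂ] h) :
    transpose e (gksl H v γm γp (transpose e x)) = gksl (-H) v γm γp x := by
  simp only [gksl_apply, transpose_sub, transpose_add, transpose_smul, transpose_mul,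
    transpose_transpose, hH, hv.transpose_eq_star, hv.transpose_star, neg_mul, mul_neg,
    mul_assoc]
  simp only [smul_sub, smul_add, smul_neg]
  abel

/-- The part of `defect` that lowers energies from the left. -/
noncomputable def defectDown (σ v : h →L[ℂ] h) (γm γp : ℝ) : (h →L[ℂ] h) → (h →L[ℂ] h) :=
  (γm : ℂ) • sandwich (v * σ) (σ * star v) - (γp : ℂ) • sandwich (σ * v) (star v * σ)

/-- The part of `defect` that raises energies from the left. -/
noncomputable def defectUp (σ v : h →L[ℂ] h) (γm γp : ℝ) : (h →L[ℂ] h) → (h →L[ℂ] h) :=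
  (γp : ℂ) • sandwich (star v * σ) (σ * v) - (γm : ℂ) • sandwich (σ * star v) (v * σ)

/-- The part of `defect` that preserves energies from the left. -/
noncomputable def defectZero (σ H v : h →L[ℂ] h) (γm γp : ℝ) : (h →L[ℂ] h) → (h →L[ℂ] h) :=
  Complex.I • (sandwich (σ * H) σ - sandwich (H * σ) σ + sandwich σ (σ * H)
      - sandwich σ (H * σ))
    - ((γm : ℂ) / 2) • (sandwich (star v * v * σ) σ - sandwich (σ * (star v * v)) σ
      + sandwich σ (σ * (star v * v)) - sandwich σ (star v * v * σ))
    - ((γp : ℂ) / 2) • (sandwich (v * star v * σ) σ - sandwich (σ * (v * star v)) σ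
      + sandwich σ (σ * (v * star v)) - sandwich σ (v * star v * σ))

theorem defect_eq (σ H v : h →L[ℂ] h) (γm γp : ℝ) :
    defect σ H v γm γp =
      defectDown σ v γm γp + defectUp σ v γm γp + defectZero σ H v γm γp := by
  funext x
  simp only [defect, predual, gksl_apply, defectDown, defectUp, defectZero, sandwich,
    Pi.add_apply, Pi.sub_apply, Pi.smul_apply, mul_sub, sub_mul, mul_add, add_mul, neg_mul,
    mul_neg, mul_smul_comm, smul_mul_assoc, mul_assoc]
  module

end Defect

end StochLimit

namespace StochLimit

/-! ### Grading by the energy transferred -/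

section Degree

variable {h : Type*} [NormedAddCommGroup h] [InnerProductSpace ℂ h]

/-- The operator `a` changes the energy `H` by `μ`. -/
def HasDegree (H : h →L[ℂ] h) (μ : ℂ) (a : h →L[ℂ] h) : Prop := H * a - a * H = μ • a

theorem HasDegree.mul {H a b : h →L[ℂ] h} {μ ν : ℂ} (ha : HasDegree H μ a)
    (hb : HasDegree H ν b) : HasDegree H (μ + ν) (a * b) := by
  have h1 : H * (a * b) - a * b * H = (H * a - a * H) * b + a * (H * b - b * H) := by
    noncomm_ring
  rw [HasDegree, h1, ha, hb, smul_mul_assoc, mul_smul_comm, add_smul]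

theorem HasDegree.star [CompleteSpace h] {H a : h →L[ℂ] h} {ω : ℝ} (hH : IsSelfAdjoint H)
    (ha : HasDegree H (-ω : ℂ) a) : HasDegree H (ω : ℂ) (star a) := by
  have h1 := congrArg Star.star ha
  rw [star_sub, star_mul, star_mul, hH.star_eq, star_smul, star_neg, Complex.star_def,
    Complex.conj_ofReal, neg_smul] at h1
  rw [HasDegree, ← neg_sub, h1, neg_neg]

theorem _root_.Commute.hasDegree_zero {H a : h →L[ℂ] h} (ha : Commute a H) :
    HasDegree H 0 a := by
  rw [HasDegree, ha.eq, sub_self, zero_smul]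

/-- The left grading operator on maps of `B(h)`. -/
def leftAd (H : h →L[ℂ] h) : Module.End ℂ ((h →L[ℂ] h) → (h →L[ℂ] h)) where
  toFun Φ := fun x => H * Φ x - Φ (H * x)
  map_add' Φ Ψ := by funext x; simp only [Pi.add_apply, mul_add]; abel
  map_smul' c Φ := by funext x; simp [smul_sub]

theorem HasDegree.sandwich_mem [CompleteSpace h] {H a : h →L[ℂ] h} {μ : ℂ}
    (ha : HasDegree H μ a) (b : h →L[ℂ] h) :
    sandwich a b ∈ (leftAd H).eigenspace μ := by
  rw [Module.End.mem_eigenspace_iff]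
  funext x
  have h1 : H * (a * x * b) - a * (H * x) * b = (H * a - a * H) * x * b := by noncomm_ring
  change H * (a * x * b) - a * (H * x) * b = μ • (a * x * b)
  rw [h1, ha, smul_mul_assoc, smul_mul_assoc]

section

variable [CompleteSpace h] {HS σ v : h →L[ℂ] h} {ω : ℝ}

theorem defectDown_mem (hσ : HasDegree HS 0 σ) (hv : HasDegree HS (-ω : ℂ) v) (γm γp : ℝ) :
    defectDown σ v γm γp ∈ (leftAd HS).eigenspace (-ω : ℂ) := by
  have h1 := hv.mul hσ
  have h2 := hσ.mul hv
  rw [add_zero] at h1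
  rw [zero_add] at h2
  exact Submodule.sub_mem _ (Submodule.smul_mem _ _ (h1.sandwich_mem _))
    (Submodule.smul_mem _ _ (h2.sandwich_mem _))

theorem defectUp_mem (hHS : IsSelfAdjoint HS) (hσ : HasDegree HS 0 σ)
    (hv : HasDegree HS (-ω : ℂ) v) (γm γp : ℝ) :
    defectUp σ v γm γp ∈ (leftAd HS).eigenspace (ω : ℂ) := by
  have h1 := (hv.star hHS).mul hσ
  have h2 := hσ.mul (hv.star hHS)
  rw [add_zero] at h1
  rw [zero_add] at h2
  exact Submodule.sub_mem _ (Submodule.smul_mem _ _ (h1.sandwich_mem _))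
    (Submodule.smul_mem _ _ (h2.sandwich_mem _))

theorem defectZero_mem (hHS : IsSelfAdjoint HS) (hσ : HasDegree HS 0 σ) {H : h →L[ℂ] h}
    (hH : HasDegree HS 0 H) (hv : HasDegree HS (-ω : ℂ) v) (γm γp : ℝ) :
    defectZero σ H v γm γp ∈ (leftAd HS).eigenspace 0 := by
  have hm : ∀ {a b : h →L[ℂ] h}, HasDegree HS 0 a → HasDegree HS 0 b → HasDegree HS 0 (a * b) :=
    fun ha hb => by simpa using ha.mul hb
  have h1 : HasDegree HS 0 (star v * v) := by simpa using (hv.star hHS).mul hv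
  have h2 : HasDegree HS 0 (v * star v) := by simpa using hv.mul (hv.star hHS)
  have key : ∀ {a : h →L[ℂ] h} (b c d f : h →L[ℂ] h), HasDegree HS 0 a →
      sandwich (a * σ) b - sandwich (σ * a) c + sandwich σ d - sandwich σ f ∈
        (leftAd HS).eigenspace 0 := fun b c d f ha =>
    Submodule.sub_mem _ (Submodule.add_mem _ (Submodule.sub_mem _ ((hm ha hσ).sandwich_mem _)
      ((hm hσ ha).sandwich_mem _)) (hσ.sandwich_mem _)) (hσ.sandwich_mem _)
  refine Submodule.sub_mem _ (Submodule.sub_mem _ (Submodule.smul_mem _ _ ?_)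
    (Submodule.smul_mem _ _ (key _ _ _ _ h1))) (Submodule.smul_mem _ _ (key _ _ _ _ h2))
  exact Submodule.sub_mem _ (Submodule.add_mem _ (Submodule.sub_mem _ ((hm hσ hH).sandwich_mem _)
    ((hm hH hσ).sandwich_mem _)) (hσ.sandwich_mem _)) (hσ.sandwich_mem _)

/-- If the defects of finitely many generators with distinct positive frequencies cancel, then
their energy lowering parts vanish separately. -/
theorem defectDown_eq_zero_of_sum_eq_zero (hHS : IsSelfAdjoint HS) (hσ : HasDegree HS 0 σ)
    {s : Finset ℝ} (hs : ∀ ω ∈ s, 0 < ω) {H v : ℝ → h →L[ℂ] h} {γm γp : ℝ → ℝ}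
    (hH : ∀ ω ∈ s, HasDegree HS 0 (H ω)) (hv : ∀ ω ∈ s, HasDegree HS (-ω : ℂ) (v ω))
    (hsum : ∑ ω ∈ s, defect σ (H ω) (v ω) (γm ω) (γp ω) = 0) {ω : ℝ} (hω : ω ∈ s) :
    defectDown σ (v ω) (γm ω) (γp ω) = 0 := by
  have hdis := (Module.End.eigenspaces_iSupIndep (leftAd HS)) (-ω : ℂ)
  refine Submodule.disjoint_def.mp hdis _ (defectDown_mem hσ (hv ω hω) _ _) ?_
  have h0 := hs ω hω
  simp only [defect_eq, Finset.sum_add_distrib] at hsum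
  rw [← Finset.add_sum_erase s _ hω, add_assoc, add_assoc] at hsum
  rw [eq_neg_of_add_eq_zero_left hsum]
  have hle : ∀ μ : ℂ, μ ≠ -ω → ∀ {Φ}, Φ ∈ (leftAd HS).eigenspace μ →
      Φ ∈ ⨆ (μ : ℂ) (_ : μ ≠ -ω), (leftAd HS).eigenspace μ := fun μ hμ _ hΦ =>
    (le_iSup₂_of_le (f := fun (μ : ℂ) (_ : μ ≠ -ω) => (leftAd HS).eigenspace μ) μ hμ le_rfl) hΦ
  refine Submodule.neg_mem _ (Submodule.add_mem _ (Submodule.sum_mem _ fun ν hν => ?_)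
    (Submodule.add_mem _ (Submodule.sum_mem _ fun ν hν => ?_)
      (Submodule.sum_mem _ fun ν hν => ?_)))
  · have hν' := Finset.mem_erase.mp hν
    refine hle _ (fun hc => hν'.1 ?_) (defectDown_mem hσ (hv ν hν'.2) _ _)
    exact_mod_cast neg_injective hc
  · refine hle _ (fun hc => ?_) (defectUp_mem hHS hσ (hv ν hν) _ _)
    have h1 : ν = -ω := by exact_mod_cast hc
    linarith [hs ν hν]
  · refine hle _ (fun hc => ?_) (defectZero_mem hHS hσ (hH ν hν) (hv ν hν) _ _)
    have h1 : (0 : ℝ) = -ω := by exact_mod_cast hc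
    linarith

end

variable [FiniteDimensional ℂ h]

theorem mul_specProj (H : h →L[ℂ] h) (ε : ℝ) : H * specProj H ε = (ε : ℂ) • specProj H ε := by
  ext x
  have h1 : specProj H ε x ∈ eigenspace H ε := Submodule.starProjection_apply_mem _ x
  exact Module.End.mem_eigenspace_iff.mp h1

variable [CompleteSpace h]

theorem specProj_mul {H : h →L[ℂ] h} (hH : IsSelfAdjoint H) (ε : ℝ) :
    specProj H ε * H = (ε : ℂ) • specProj H ε := by
  have h1 : star (specProj H ε) = specProj H ε :=
    (isSelfAdjoint_starProjection (eigenspace H ε)).star_eq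
  have h2 := congrArg Star.star (mul_specProj H ε)
  rwa [star_mul, hH.star_eq, star_smul, h1, Complex.star_def, Complex.conj_ofReal] at h2

theorem hasDegree_freqPart {H : h →L[ℂ] h} (hH : IsSelfAdjoint H) (V : h →L[ℂ] h) (ω : ℝ) :
    HasDegree H (-ω : ℂ) (freqPart H V ω) := by
  rw [HasDegree, freqPart, Finset.mul_sum, Finset.sum_mul, ← Finset.sum_sub_distrib,
    Finset.smul_sum]
  refine Finset.sum_congr rfl fun p hp => ?_
  rw [← (Finset.mem_filter.mp hp).2, ← mul_assoc, ← mul_assoc, mul_specProj,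
    mul_assoc (specProj H p.2 * V), specProj_mul hH, smul_mul_assoc, smul_mul_assoc,
    mul_smul_comm, ← sub_smul]
  push_cast
  ring_nf

end Degree

/-! ### Vanishing of the defect of a single generator -/

section Local

variable {h : Type*} [NormedAddCommGroup h] [InnerProductSpace ℂ h] [CompleteSpace h]

/-- Proportional conjugations by `a ≠ 0` and `b` force `a` and `b` to be proportional. -/
theorem exists_eq_smul_of_sandwich_eq {a b : h →L[ℂ] h} {g k : ℂ} (hg : g ≠ 0)
    (hab : ∀ x, g • (a * x * star a) = k • (b * x * star b)) (ha : a ≠ 0) :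
    ∃ c : ℂ, a = c • b := by
  obtain ⟨q, hq⟩ : ∃ q, a q ≠ 0 := by
    by_contra! hq
    exact ha (ContinuousLinearMap.ext hq)
  have hq' : (inner ℂ (a q) (a q) : ℂ) ≠ 0 := inner_self_ne_zero.mpr hq
  refine ⟨(g * inner ℂ (a q) (a q))⁻¹ * (k * inner ℂ (b q) (a q)), ?_⟩
  ext p
  have h1 := congrArg (fun T : h →L[ℂ] h => T (a q)) (hab (InnerProductSpace.rankOne ℂ p q))
  simp only [ContinuousLinearMap.star_eq_adjoint, smul_apply,
    mul_apply_eq_comp, InnerProductSpace.rankOne_apply, map_smul,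
    ContinuousLinearMap.adjoint_inner_right, smul_smul] at h1
  rw [smul_apply, mul_smul, ← h1, smul_smul,
    inv_mul_cancel₀ (mul_ne_zero hg hq'), one_smul]

variable [FiniteDimensional ℂ h]

theorem defect_eq_zero {σ H v : h →L[ℂ] h} {γm γp : ℝ} (hσ : 0 ≤ σ) (hσu : IsUnit σ)
    (hγm : 0 < γm) {a b : ℂ} (hH : H = a • (star v * v) + b • (v * star v))
    (hdown : defectDown σ v γm γp = 0) : defect σ H v γm γp = 0 := by
  have hσs : star σ = σ := (IsSelfAdjoint.of_nonneg hσ).star_eq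
  have hγ : (γm : ℂ) ≠ 0 := by exact_mod_cast hγm.ne'
  have hD : ∀ x, (γm : ℂ) • (v * σ * x * (σ * star v)) =
      (γp : ℂ) • (σ * v * x * (star v * σ)) := fun x =>
    sub_eq_zero.mp (congrFun hdown x)
  rcases eq_or_ne v 0 with rfl | hv0
  · funext x
    simp [defect, predual, gksl_apply, hH]
  have hvσ0 : v * σ ≠ 0 := fun hc => hv0 (hσu.mul_left_eq_zero.mp hc)
  obtain ⟨c, hc⟩ := exists_eq_smul_of_sandwich_eq (b := σ * v) hγ
    (fun x => by simpa only [star_mul, hσs] using hD x) hvσ0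
  have hc' : σ * star v = star c • (star v * σ) := by
    simpa only [star_mul, star_smul, hσs] using congrArg star hc
  have hc0 : c ≠ 0 := fun h0 => hvσ0 (by rw [hc, h0, zero_smul])
  have hcγ : (γm : ℂ) * (c * star c) = γp := by
    have h1 := hD 1
    rw [hc, hc', mul_one, mul_one, smul_mul_smul_comm, smul_smul] at h1
    have h2 : σ * v * (star v * σ) ≠ 0 := fun h3 => by
      have h4 : star (star v * σ) * (star v * σ) = 0 := by simpa [hσs] using h3
      have h5 : star v * σ = 0 := eq_zero_of_tr_star_mul_self (by rw [h4, tr_zero])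
      exact hv0 (star_eq_zero.mp (hσu.mul_left_eq_zero.mp h5))
    exact smul_left_injective ℂ h2 h1
  have hcr : star c = c := by
    obtain ⟨w, hw0⟩ : ∃ w : h →L[ℂ] h, w = CFC.sqrt σ := ⟨_, rfl⟩
    have hww : w * w = σ := by rw [hw0]; exact CFC.sqrt_mul_sqrt_self σ hσ
    have hws : star w = w := by
      rw [hw0]; exact (IsSelfAdjoint.of_nonneg (CFC.sqrt_nonneg σ)).star_eq
    have hwu : IsUnit w := by rw [hw0]; exact (CFC.isUnit_sqrt_iff σ hσ).mpr hσu
    have h1 : tr (star v * σ * v) ≠ 0 := fun h2 => by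
      have h3 : tr (star (w * v) * (w * v)) = 0 := by
        rw [← h2, star_mul, hws, ← hww]; simp only [mul_assoc]
      exact hv0 (hwu.mul_right_eq_zero.mp (eq_zero_of_tr_star_mul_self h3))
    have h2 : tr (star v * (v * σ)) = c * tr (star v * σ * v) := by
      rw [hc, mul_smul_comm, tr_smul, mul_assoc]
    have h3 : tr (star v * (v * σ)) = star c * tr (star v * σ * v) := by
      rw [← mul_assoc, tr_mul_comm, ← mul_assoc, hc', smul_mul_assoc, tr_smul]
    exact mul_right_cancel₀ h1 (h3.symm.trans h2)
  rw [hcr] at hc' hcγ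
  have hmm : star v * v * σ = σ * (star v * v) := by
    rw [mul_assoc, hc, mul_smul_comm, ← mul_assoc σ, hc', smul_mul_assoc, mul_assoc]
  have hpp : v * star v * σ = σ * (v * star v) := by
    apply smul_right_injective _ hc0
    change c • (v * star v * σ) = c • (σ * (v * star v))
    rw [mul_assoc, ← mul_smul_comm, ← hc', ← mul_assoc, ← mul_assoc, ← smul_mul_assoc, ← hc]
  have hHσ : H * σ = σ * H := by
    rw [hH, add_mul, mul_add, smul_mul_assoc, smul_mul_assoc, hmm, hpp, mul_smul_comm,
      mul_smul_comm]
  have hup : defectUp σ v γm γp = 0 := by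
    funext x
    change (γp : ℂ) • (star v * σ * x * (σ * v)) - (γm : ℂ) • (σ * star v * x * (v * σ)) = 0
    rw [hc, hc', smul_mul_assoc, smul_mul_smul_comm, smul_smul, hcγ, sub_self]
  have hzero : defectZero σ H v γm γp = 0 := by
    rw [defectZero, hHσ, hmm, hpp]
    simp
  rw [defect_eq, hdown, hup, hzero, add_zero, add_zero]

end Local

/-! ### Detailed balance in terms of the defect -/

section Main

variable {h : Type*} [NormedAddCommGroup h] [InnerProductSpace ℂ h]

theorem bohr_pos [FiniteDimensional ℂ h] {H : h →L[ℂ] h} {ω : ℝ} (hω : ω ∈ bohr H) : 0 < ω := by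
  obtain ⟨p, hp, rfl⟩ := Finset.mem_image.mp hω
  exact sub_pos.mpr (Finset.mem_filter.mp hp).2

variable [CompleteSpace h]

theorem gksl_one (H v : h →L[ℂ] h) (γm γp : ℝ) : gksl H v γm γp 1 = 0 := by
  rw [gksl_apply]
  simp only [mul_one, one_mul, sub_self, smul_zero]
  module

variable [FiniteDimensional ℂ h]

theorem IsFaithfulState.isUnit {ρ : h →L[ℂ] h} (hρ : IsFaithfulState ρ) : IsUnit ρ := by
  have h1 : LinearMap.ker (ρ : h →ₗ[ℂ] h) = ⊥ := by
    let P := (LinearMap.ker (ρ : h →ₗ[ℂ] h)).starProjection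
    have hP : ∀ x, P x ∈ LinearMap.ker (ρ : h →ₗ[ℂ] h) := Submodule.starProjection_apply_mem _
    have h2 : ρ * (star P * P) = 0 := by
      rw [(isSelfAdjoint_starProjection _).star_eq,
        (Submodule.isIdempotentElem_starProjection _).eq]
      ext x
      exact hP x
    have h3 : P = 0 := hρ.2.2 P (by rw [h2, tr_zero])
    rw [Submodule.eq_bot_iff]
    intro x hx
    have h4 : P x = x := Submodule.starProjection_eq_self_iff.mpr hx
    rw [← h4, h3, zero_apply]
  exact ContinuousLinearMap.isUnit_iff_bijective.mpr ⟨LinearMap.ker_eq_bot.mp h1,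
    LinearMap.range_eq_top.mp (LinearMap.ker_eq_bot_iff_range_eq_top.mp h1)⟩

/-- Detailed balance of a semigroup generated by a sum of GKSL generators is the vanishing of
the sum of their defects. -/
theorem sqdbTheta_sum_iff {d : ℕ} {e : OrthonormalBasis (Fin d) ℂ h} {ι : Type*} (s : Finset ι)
    {H v : ι → h →L[ℂ] h} (γm γp : ι → ℝ) (hH : ∀ i ∈ s, transpose e (H i) = H i)
    (hv : ∀ i ∈ s, IsRealMatrix e (v i)) (ρ : h →L[ℂ] h) :
    SQDBTheta e (semigroup (∑ i ∈ s, gksl (H i) (v i) (γm i) (γp i))) ρ ↔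
      ∑ i ∈ s, defect (CFC.sqrt ρ) (H i) (v i) (γm i) (γp i) = 0 := by
  rw [sqdbTheta_semigroup_iff, funext_iff]
  refine forall_congr' fun x => ?_
  have hl : ∀ y, tr (CFC.sqrt ρ * x * CFC.sqrt ρ *
      (∑ i ∈ s, gksl (H i) (v i) (γm i) (γp i)) y) =
      tr ((∑ i ∈ s, predual (H i) (v i) (γm i) (γp i) (CFC.sqrt ρ * x * CFC.sqrt ρ)) * y) :=
    fun y => by
      rw [sum_apply, Finset.mul_sum, Finset.sum_mul, tr_sum, tr_sum]
      exact Finset.sum_congr rfl fun i _ => tr_mul_gksl _ _ _ _ _ _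
  have hr : transpose e ((∑ i ∈ s, gksl (H i) (v i) (γm i) (γp i)) (transpose e x)) =
      ∑ i ∈ s, gksl (-H i) (v i) (γm i) (γp i) x := by
    rw [sum_apply, ← transposeCLM_apply, map_sum]
    exact Finset.sum_congr rfl fun i hi => transpose_gksl (hH i hi) (hv i hi) _ _ _
  rw [Finset.sum_apply, Pi.zero_apply]
  simp only [hl, hr, defect, Finset.sum_sub_distrib, sub_eq_zero]
  rw [← Finset.sum_mul, ← Finset.mul_sum]
  exact ⟨eq_of_tr_mul_eq, fun heq y => by rw [heq]⟩

end Main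

end StochLimit

theorem mainTheorem4 {h : Type*} [NormedAddCommGroup h] [InnerProductSpace ℂ h]
    [FiniteDimensional ℂ h] [CompleteSpace h]
    -- the system Hamiltonian and an orthonormal basis of eigenvectors of it
    (HS : h →L[ℂ] h) (hHS : IsSelfAdjoint HS)
    (d : ℕ) (e : OrthonormalBasis (Fin d) ℂ h)
    (he : ∀ i, ∃ ε : ℝ, HS (e i) = (ε : ℂ) • e i)
    -- the operator `V`, the Hamiltonians `H_ω` and the constants `γ_ω^∓`
    (V : h →L[ℂ] h) (Hω : ℝ → (h →L[ℂ] h)) (γm γp : ℝ → ℝ)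
    (hHsa : ∀ ω ∈ StochLimit.bohr HS, IsSelfAdjoint (Hω ω))
    (hHcomm : ∀ ω ∈ StochLimit.bohr HS, Commute (Hω ω) HS)
    (hγm : ∀ ω ∈ StochLimit.bohr HS, 0 < γm ω)
    (hγp : ∀ ω ∈ StochLimit.bohr HS, 0 < γp ω)
    -- the faithful invariant state
    (ρ : h →L[ℂ] h) (hρ : StochLimit.IsFaithfulState ρ) (hρHS : Commute ρ HS)
    (hinv : StochLimit.IsInvariant
      (StochLimit.semigroup (StochLimit.globalGen HS V Hω γm γp)) ρ)
    -- the assumptions on `V_ω` and `H_ω`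
    (hreal : ∀ ω ∈ StochLimit.bohr HS,
      StochLimit.IsRealMatrix e (StochLimit.freqPart HS V ω))
    (hlin : ∀ ω ∈ StochLimit.bohr HS, ∃ a b : ℂ, Hω ω =
      a • (star (StochLimit.freqPart HS V ω) * StochLimit.freqPart HS V ω)
        + b • (StochLimit.freqPart HS V ω * star (StochLimit.freqPart HS V ω))) :
    StochLimit.SQDBTheta e (StochLimit.semigroup (StochLimit.globalGen HS V Hω γm γp)) ρ ↔
      ∀ ω ∈ StochLimit.bohr HS,
        StochLimit.IsInvariant
            (StochLimit.semigroup (StochLimit.localGen HS V Hω γm γp ω)) ρ ∧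
          StochLimit.SQDBTheta e
            (StochLimit.semigroup (StochLimit.localGen HS V Hω γm γp ω)) ρ := by
  have hρ0 : 0 ≤ ρ := (ContinuousLinearMap.nonneg_iff_isPositive ρ).mpr hρ.1
  have hσ0 : 0 ≤ CFC.sqrt ρ := CFC.sqrt_nonneg ρ
  have hσu : IsUnit (CFC.sqrt ρ) := (CFC.isUnit_sqrt_iff ρ hρ0).mpr hρ.isUnit
  have hσHS : Commute (CFC.sqrt ρ) HS := hρHS.cfcₙ_nnreal _
  have hHt : ∀ ω ∈ StochLimit.bohr HS, StochLimit.transpose e (Hω ω) = Hω ω := fun ω hω => by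
    obtain ⟨a, b, hab⟩ := hlin ω hω
    rw [hab, StochLimit.transpose_add, StochLimit.transpose_smul, StochLimit.transpose_smul,
      StochLimit.transpose_mul, StochLimit.transpose_mul, (hreal ω hω).transpose_eq_star,
      (hreal ω hω).transpose_star]
  have hglobal := StochLimit.sqdbTheta_sum_iff (StochLimit.bohr HS) γm γp hHt hreal ρ
  have hlocal : ∀ ω ∈ StochLimit.bohr HS,
      (StochLimit.SQDBTheta e
        (StochLimit.semigroup (StochLimit.localGen HS V Hω γm γp ω)) ρ ↔
        StochLimit.defect (CFC.sqrt ρ) (Hω ω) (StochLimit.freqPart HS V ω) (γm ω) (γp ω) = 0) :=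
    fun ω hω => by
      have h1 := StochLimit.sqdbTheta_sum_iff (e := e) {ω} (H := Hω)
        (v := StochLimit.freqPart HS V) γm γp
        (fun i hi => by rw [Finset.mem_singleton.mp hi]; exact hHt ω hω)
        (fun i hi => by rw [Finset.mem_singleton.mp hi]; exact hreal ω hω) ρ
      rwa [Finset.sum_singleton, Finset.sum_singleton] at h1
  constructor
  · intro hdb ω hω
    obtain ⟨a, b, hab⟩ := hlin ω hω
    have hdown := StochLimit.defectDown_eq_zero_of_sum_eq_zero hHS hσHS.hasDegree_zero
      (fun _ => StochLimit.bohr_pos) (fun ω hω => (hHcomm ω hω).hasDegree_zero)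
      (fun ω _ => StochLimit.hasDegree_freqPart hHS V ω) (hglobal.mp hdb) hω
    have hloc := (hlocal ω hω).mpr (StochLimit.defect_eq_zero hσ0 hσu (hγm ω hω) hab hdown)
    have hone : StochLimit.localGen HS V Hω γm γp ω 1 = 0 := StochLimit.gksl_one _ _ _ _
    exact ⟨hloc.isInvariant hρ0 fun t _ => StochLimit.semigroup_apply_of_eq_zero hone t, hloc⟩
  · intro hloc
    exact hglobal.mpr (Finset.sum_eq_zero fun ω hω => (hlocal ω hω).mp (hloc ω hω).2)
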